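/- Let $M\subset\mathbb C^{n+1}$ be a real-analytic hypersurface through $0$, given near $0$ by $\rho(Z,\bar Z)=0$, where $Z=(z,w)\in\mathbb C^n\times\mathbb C$ and $\rho$ is a real-valued real-analytic function near $0$, regarded as a convergent power series in $(Z,\bar Z)$, with $\rho_w(0,0)\ne 0$ and $\rho_z(0,0)=0$. Suppose that $M$ is transversally holomorphically embeddable into a real hyperquadric $M'\subset\mathbb C^{n+m+1}$; that is, $M'$ is given in some linear coordinates $(z',w')\in\mathbb C^{n+m}\times\mathbb C$ by $\operatorname{Im} w'=h(z',\bar z')$ with a (possibly degenerate) hermitian form $h$, and there is a holomorphic embedding $H$ of a neighborhood of $M$ into $\mathbb C^{n+m+1}$ with $H(M)\subset M'$ and $H_*(T_x\mathbb C^{n+1})+T_{H(x)}M'=T_{H(x)}\mathbb C^{n+m+1}$ for all $x\in M$. For $\zeta$ near $0$ let $S_\zeta=\{Z:\rho(Z,\bar\zeta)=0\}$ be the Segre variety. Fix a proper subset $I\subset\{1,\dots,n\}$ and put $V_I=(\operatorname{span}\{e_j:j\in I\}\times\mathbb C)\cap T_0^cM$, where $e_1,\dots,e_n$ is the standard basis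 of $\mathbb C^n$ and $T_0^cM=T_0M\cap iT_0M$, and $S_{0,V_I}=\{Z\in S_0: T_0S_Z\supset V_I\}$. Then for any $m+1$ multiindices $\alpha_1,\dots,\alpha_{m+1}\in\mathbb N^n$ with $|\alpha_j|=2$ and $\operatorname{supp}\alpha_j\subset I$ there are a constant vector $(\lambda_1,\dots,\lambda_{m+1})\in\mathbb C^{m+1}\setminus\{0\}$ and a polynomial $R_1$ in $n+1$ variables with complex coefficients and of degree at most $1$ such that $$\sum_{j=1}^{m+1}\lambda_j\,\rho_{z^{\alpha_j}}(0,\bar\zeta)=R_1\bigl(\rho_{z_1}(0,\bar\zeta),\dots,\rho_{z_n}(0,\bar\zeta),\rho_w(0,\bar\zeta)\bigr)$$ for all $\zeta\in S_{0,V_I}$ sufficiently close to $0$. -/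

import Mathlib

open Filter Topology

noncomputable section

namespace CRHyp

/-- The space `ℂ^{n+1} = ℂ^n × ℂ` with its coordinates `Z = (z, w)`.
`star Z` is the coordinatewise complex conjugate. -/
abbrev Space (n : ℕ) : Type := (Fin n → ℂ) × ℂ

/-- The partial derivative `∂f/∂z_i` at `Z`. -/
def dz {n : ℕ} (i : Fin n) (f : Space n → ℂ) (Z : Space n) : ℂ :=
  fderiv ℂ f Z (Pi.single i 1, 0)

/-- The partial derivative `∂f/∂w` at `Z`. -/
def dw {n : ℕ} (f : Space n → ℂ) (Z : Space n) : ℂ :=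
  fderiv ℂ f Z (0, 1)

/-- The iterated partial derivative `f_{z^α} = ∂^{|α|} f / ∂z_1^{α_1} ⋯ ∂z_n^{α_n}`. -/
def dzMulti {n : ℕ} (α : Fin n → ℕ) (f : Space n → ℂ) : Space n → ℂ :=
  (List.finRange n).foldr (fun i g => (dz i)^[α i] g) f

/-- `ρ(Z, Z̄)` is a real-analytic defining function near `0` of the set `M ∋ 0`. The function `ρ` is
a power series in two independent variables, convergent near the origin, i.e. it is
the complexification of the real-analytic function `Z ↦ ρ(Z, Z̄)`, which is real-valued. -/
structure IsDefiningFunction {n : ℕ} (ρ : Space n × Space n → ℂ) (M : Set (Space n)) : Prop where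
  zero_mem : (0 : Space n) ∈ M
  analytic : AnalyticAt ℂ ρ (0, 0)
  real : ∀ᶠ Z in 𝓝 (0 : Space n), (ρ (Z, star Z)).im = 0
  mem_iff : ∀ᶠ Z in 𝓝 (0 : Space n), Z ∈ M ↔ ρ (Z, star Z) = 0

/-- `Z ↦ ρ(Z, ζ̄)`. -/
def slice {n : ℕ} (ρ : Space n × Space n → ℂ) (ζ : Space n) : Space n → ℂ :=
  fun Z => ρ (Z, star ζ)

/-- The first order derivatives of `ρ(Z, ζ̄)` in `Z = (z, w)` at `(0, ζ̄)`: `some i` is `ρ_{z_i}`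
and `none` is `ρ_w`. -/
def firstDerivs {n : ℕ} (ρ : Space n × Space n → ℂ) (ζ : Space n) : Option (Fin n) → ℂ
  | some i => dz i (slice ρ ζ) 0
  | none => dw (slice ρ ζ) 0

/-- The Segre variety `S_ζ = {Z : ρ(Z, ζ̄) = 0}`. -/
def segre {n : ℕ} (ρ : Space n × Space n → ℂ) (ζ : Space n) : Set (Space n) :=
  {Z | slice ρ ζ Z = 0}

/-- The complex tangent space at `p` of the Segre variety `S_ζ ∋ p`
(the kernel of the differential of its holomorphic defining function). -/
def segreTangent {n : ℕ} (ρ : Space n × Space n → ℂ) (p ζ : Space n) : Submodule ℂ (Space n) :=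
  LinearMap.ker (fderiv ℂ (slice ρ ζ) p : Space n →ₗ[ℂ] ℂ)

/-- The real tangent space `T_0 M` of `M = {ρ(Z, Z̄) = 0}`. -/
def realTangent {n : ℕ} (ρ : Space n × Space n → ℂ) : Submodule ℝ (Space n) :=
  LinearMap.ker (fderiv ℝ (fun Z : Space n => ρ (Z, star Z)) 0 : Space n →ₗ[ℝ] ℂ)

/-- The complex tangent space `T_0^c M = T_0 M ∩ i T_0 M`. -/
def complexTangent {n : ℕ} (ρ : Space n × Space n → ℂ) : Submodule ℂ (Space n) where
  carrier := {v | v ∈ realTangent ρ ∧ Complex.I • v ∈ realTangent ρ}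
  zero_mem' := by simp
  add_mem' := by
    rintro a b ⟨ha, ha'⟩ ⟨hb, hb'⟩
    refine ⟨add_mem ha hb, ?_⟩
    rw [smul_add]
    exact add_mem ha' hb'
  smul_mem' := by
    rintro c v ⟨hv, hv'⟩
    have h1 : c • v = c.re • v + c.im • (Complex.I • v) := by
      conv_lhs => rw [← Complex.re_add_im c]
      rw [add_smul, mul_smul, Complex.coe_smul, Complex.coe_smul]
    have h2 : Complex.I • (c • v) = c.re • (Complex.I • v) - c.im • v := by
      have h : Complex.I * c = (c.re : ℂ) * Complex.I - (c.im : ℂ) := by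
        apply Complex.ext <;> simp
      rw [← mul_smul, h, sub_smul, mul_smul, Complex.coe_smul, Complex.coe_smul]
    exact ⟨h1 ▸ add_mem (Submodule.smul_mem _ _ hv) (Submodule.smul_mem _ _ hv'),
      h2 ▸ sub_mem (Submodule.smul_mem _ _ hv') (Submodule.smul_mem _ _ hv)⟩

/-- The subspace `V_I = (span {e_j : j ∈ I} × ℂ) ∩ T_0^c M`. -/
def coordSubspace {n : ℕ} (ρ : Space n × Space n → ℂ) (I : Set (Fin n)) :
    Submodule ℂ (Space n) :=
  (Submodule.span ℂ ((fun j : Fin n => (Pi.single j 1 : Fin n → ℂ)) '' I)).prod ⊤ ⊓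
    complexTangent ρ

/-- The distinguished subset `S_{0,V} = {Z ∈ S_0 : T_0 S_Z ⊇ V}` of the Segre variety `S_0`. -/
def distinguished {n : ℕ} (ρ : Space n × Space n → ℂ) (V : Submodule ℂ (Space n)) :
    Set (Space n) :=
  {ζ | ζ ∈ segre ρ 0 ∧ V ≤ segreTangent ρ 0 ζ}

/-- A real hyperquadric in `ℂ^{N+1}`: linear coordinates `(z, w) ∈ ℂ^N × ℂ` and a (possibly
degenerate) hermitian form `h`, given by its matrix. -/
structure Hyperquadric (N : ℕ) where
  coord : (Fin (N + 1) → ℂ) ≃ₗ[ℂ] (Fin N → ℂ) × ℂ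
  form : Matrix (Fin N) (Fin N) ℂ
  hermitian : form.IsHermitian

namespace Hyperquadric

/-- The defining function `Im w - h(z, z̄)`, where `h(z, z̄) = ∑ A_{jk} z̄_j z_k`. -/
def defFun {N : ℕ} (Q : Hyperquadric N) (Z : Fin (N + 1) → ℂ) : ℝ :=
  (Q.coord Z).2.im - (star (Q.coord Z).1 ⬝ᵥ Q.form.mulVec (Q.coord Z).1).re

/-- The hyperquadric `{Im w = h(z, z̄)}` as a set. -/
def carrier {N : ℕ} (Q : Hyperquadric N) : Set (Fin (N + 1) → ℂ) :=
  {Z | Q.defFun Z = 0}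

/-- The real tangent space of the hyperquadric at a point `y` of it. -/
def tangent {N : ℕ} (Q : Hyperquadric N) (y : Fin (N + 1) → ℂ) :
    Submodule ℝ (Fin (N + 1) → ℂ) :=
  LinearMap.ker (fderiv ℝ Q.defFun y : (Fin (N + 1) → ℂ) →ₗ[ℝ] ℝ)

end Hyperquadric

/-- `M ⊆ ℂ^{n+1}` is transversally holomorphically embeddable into the hyperquadric `M'`: there is a
holomorphic embedding `H` (an immersion that is a homeomorphism onto its image) of an open
neighbourhood `U` of `M` into `ℂ^{N+1}` with `H(M) ⊆ M'` and
`H_*(T_x ℂ^{n+1}) + T_{H(x)} M' = T_{H(x)} ℂ^{N+1}` for all `x ∈ M`. -/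
def TransversallyEmbeddable {n N : ℕ} (M : Set (Space n)) (M' : Hyperquadric N) : Prop :=
  ∃ (U : Set (Space n)) (H : Space n → Fin (N + 1) → ℂ),
    IsOpen U ∧ M ⊆ U ∧
    DifferentiableOn ℂ H U ∧
    (∀ x ∈ U, Function.Injective (fderiv ℂ H x)) ∧
    IsEmbedding (U.domRestrict H) ∧
    Set.MapsTo H M M'.carrier ∧
    ∀ x ∈ M, (LinearMap.range (fderiv ℂ H x : Space n →ₗ[ℂ] (Fin (N + 1) → ℂ))).restrictScalars ℝ ⊔
      M'.tangent (H x) = ⊤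

end CRHyp

end

/-! Write `f` for the embedding in the linear coordinates of the hyperquadric. Polarizing `Im w' -
h` gives `G(Z, χ) = B(χ)(f(Z)) + c(χ)`, with `B(χ)` a linear functional, and `G` vanishes on the
complexified hypersurface `ρ(Z, χ) = 0` because it vanishes on `M`
(`eventually_vanish_of_vanish_on_real`). Hence at points `(0, χ)` of that hypersurface the
`Z`-derivatives of `G` are a common multiple of those of `ρ`: all first derivatives, and second
derivatives in directions annihilated by the differential of `ρ` (`eventually_exists_proportional`).
Transversality makes the factor nonzero (`exists_polar_ne_zero`).

The derivatives of `G` are `B(χ)` applied to vectors independent of `χ`. The range of `df(0)` has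
dimension `n + 1` in a space of dimension `n + m + 1`, so some nontrivial constant combination of
the `m + 1` second derivatives of `f` equals `df(0) u`. Applying `B(χ)` and cancelling the factor
turns this into the asserted relation, with `R` the linear form of differentiation along `u`.
Membership in the distinguished set ensures that `ρ(0, ζ̄) = 0` and that the directions indexed by
`I` are tangential. -/

noncomputable section

/-! ### Derivatives of functions vanishing on a smooth zero set -/

/-- The implicit function theorem along a direction `e` transversal to the zero set. -/
theorem exists_implicit_along {E : Type*} [NormedAddCommGroup E] [NormedSpace ℂ E]
    [CompleteSpace E] {ρ : E → ℂ} {p e : E} (hρ : ContDiffAt ℂ 1 ρ p) (hp : ρ p = 0)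
    (he : fderiv ℂ ρ p e ≠ 0) :
    ∃ τ : E → ℂ, ContDiffAt ℂ 1 τ p ∧ τ p = 0 ∧ (∀ᶠ x in 𝓝 p, ρ (x + τ x • e) = 0) ∧
      ∀ᶠ v : E × ℂ in 𝓝 (p, 0), ρ (v.1 + v.2 • e) = 0 → τ v.1 = v.2 := by
  set F : E × ℂ → ℂ := fun v => ρ (v.1 + v.2 • e) with hF
  have hp' : (p, (0 : ℂ)).1 + (p, (0 : ℂ)).2 • e = p := by simp
  have hlin : HasFDerivAt (fun v : E × ℂ => v.1 + v.2 • e)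
      (ContinuousLinearMap.fst ℂ E ℂ + (ContinuousLinearMap.snd ℂ E ℂ).smulRight e) (p, 0) :=
    (ContinuousLinearMap.fst ℂ E ℂ +
      (ContinuousLinearMap.snd ℂ E ℂ).smulRight e).hasFDerivAt
  have hFc : ContDiffAt ℂ 1 F (p, 0) := by
    refine ContDiffAt.comp (g := ρ) (p, (0 : ℂ)) ?_ ?_
    · rw [hp']; exact hρ
    · fun_prop
  have hd : HasFDerivAt F _ (p, 0) :=
    HasFDerivAt.comp (g := ρ) (g' := fderiv ℂ ρ p) (p, (0 : ℂ))
      (by rw [hp']; exact (hρ.differentiableAt one_ne_zero).hasFDerivAt) hlin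
  have hinv : (fderiv ℂ F (p, 0) ∘L .inr ℂ E ℂ).IsInvertible := by
    refine ⟨ContinuousLinearEquiv.unitsEquivAut ℂ (Units.mk0 _ he), ?_⟩
    ext
    simp [hd.fderiv]
  have h0 : F (p, 0) = 0 := by simp [hF, hp]
  refine ⟨hFc.implicitFunction one_ne_zero hinv, hFc.contDiffAt_implicitFunction _ _,
    hFc.implicitFunction_apply_self _ _, ?_, ?_⟩
  · filter_upwards [hFc.eventually_apply_implicitFunction one_ne_zero hinv] with x hx
    rw [h0] at hx
    exact hx
  · filter_upwards [hFc.eventually_apply_eq_iff_implicitFunction one_ne_zero hinv] with v hv h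
    rw [h0] at hv
    exact hv.1 h

/-- If `G` vanishes on the zero set of `ρ`, the differential of `G` is proportional to that of `ρ`
on this set. -/
theorem fderiv_mul_eq_of_vanish {E : Type*} [NormedAddCommGroup E] [NormedSpace ℂ E]
    [CompleteSpace E] {ρ G : E → ℂ} {p e : E} (hρ : ContDiffAt ℂ 1 ρ p) (hp : ρ p = 0)
    (he : fderiv ℂ ρ p e ≠ 0) (hG : DifferentiableAt ℂ G p)
    (hv : ∀ᶠ q in 𝓝 p, ρ q = 0 → G q = 0) (u : E) :
    fderiv ℂ G p u * fderiv ℂ ρ p e = fderiv ℂ G p e * fderiv ℂ ρ p u := by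
  obtain ⟨τ, hτ, hτp, hz, -⟩ := exists_implicit_along hρ hp he
  have hτd := (hτ.differentiableAt one_ne_zero).hasFDerivAt
  have hφ : HasFDerivAt (fun x => x + τ x • e)
      (ContinuousLinearMap.id ℂ E + (fderiv ℂ τ p).smulRight e) p :=
    (hasFDerivAt_id p).add (hτd.smul_const e)
  have hφp : p + τ p • e = p := by simp [hτp]
  -- The map `x ↦ x + τ x • e` fixes `p` and retracts onto the zero set. Applying the chain rule to
  -- both `ρ` and `G` gives two equations from which the derivative of `τ` is eliminated.
  have key : ∀ f : E → ℂ, DifferentiableAt ℂ f p → (∀ᶠ x in 𝓝 p, f (x + τ x • e) = 0) →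
      fderiv ℂ f p u + fderiv ℂ τ p u * fderiv ℂ f p e = 0 := by
    intro f hf hf0
    have h1 : HasFDerivAt (fun x => f (x + τ x • e)) _ p :=
      HasFDerivAt.comp (g := f) (g' := fderiv ℂ f p) p (by rw [hφp]; exact hf.hasFDerivAt) hφ
    have h2 : HasFDerivAt (fun x => f (x + τ x • e)) (0 : E →L[ℂ] ℂ) p :=
      (hasFDerivAt_const (0 : ℂ) p).congr_of_eventuallyEq hf0
    simpa using DFunLike.congr_fun (h1.unique h2) u
  have hcont : Tendsto (fun x => x + τ x • e) (𝓝 p) (𝓝 p) := by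
    simpa only [hφp] using hφ.continuousAt.tendsto
  have h1 := key ρ (hρ.differentiableAt one_ne_zero) hz
  have h2 := key G hG (by
    filter_upwards [hz, hcont.eventually hv] with x hx hx'
    exact hx' hx)
  linear_combination fderiv ℂ ρ p e * h2 - fderiv ℂ G p e * h1

/-- Second order version of `fderiv_mul_eq_of_vanish`, in directions tangent to the zero set. -/
theorem fderiv_fderiv_mul_eq_of_vanish {E : Type*} [NormedAddCommGroup E] [NormedSpace ℂ E]
    [CompleteSpace E] {ρ G : E → ℂ} {p e u v : E} (hρ : AnalyticAt ℂ ρ p) (hp : ρ p = 0)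
    (he : fderiv ℂ ρ p e ≠ 0) (hG : ∀ᶠ q in 𝓝 p, DifferentiableAt ℂ G q)
    (hGu : DifferentiableAt ℂ (fun q => fderiv ℂ G q u) p)
    (hGe : DifferentiableAt ℂ (fun q => fderiv ℂ G q e) p)
    (hv : ∀ᶠ q in 𝓝 p, ρ q = 0 → G q = 0)
    (hu0 : fderiv ℂ ρ p u = 0) (hv0 : fderiv ℂ ρ p v = 0) :
    fderiv ℂ (fun q => fderiv ℂ G q u) p v * fderiv ℂ ρ p e =
      fderiv ℂ G p e * fderiv ℂ (fun q => fderiv ℂ ρ q u) p v := by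
  have hρ1 : ContDiffAt ℂ 1 ρ p := hρ.contDiffAt
  have hρd : ∀ w, DifferentiableAt ℂ (fun q => fderiv ℂ ρ q w) p := fun w =>
    hρ.fderiv.differentiableAt.clm_apply (differentiableAt_const w)
  -- The first-order relation holds at all nearby zeros of `ρ`, so it is itself a function to which
  -- the first-order lemma applies. In its derivative at `p`, the terms containing an
  -- undifferentiated `u`-derivative drop out.
  have hK : ∀ᶠ q in 𝓝 p, ρ q = 0 →
      fderiv ℂ G q u * fderiv ℂ ρ q e - fderiv ℂ G q e * fderiv ℂ ρ q u = 0 := by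
    filter_upwards [hv.eventually_nhds, hG, hρ.eventually_analyticAt,
      (hρd e).continuousAt.eventually_ne he] with q h1 h2 h3 h4 h5
    exact sub_eq_zero.2 (fderiv_mul_eq_of_vanish h3.contDiffAt h5 h4 h2 h1 u)
  have hK' : HasFDerivAt
      (fun q => fderiv ℂ G q u * fderiv ℂ ρ q e - fderiv ℂ G q e * fderiv ℂ ρ q u) _ p :=
    (hGu.hasFDerivAt.mul (hρd e).hasFDerivAt).sub (hGe.hasFDerivAt.mul (hρd u).hasFDerivAt)
  have h := fderiv_mul_eq_of_vanish hρ1 hp he hK'.differentiableAt hK v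
  have hGu0 : fderiv ℂ G p u = 0 := by
    have := fderiv_mul_eq_of_vanish hρ1 hp he hG.self_of_nhds hv u
    rw [hu0, mul_zero] at this
    exact (mul_eq_zero.1 this).resolve_right he
  rw [hv0, mul_zero, hK'.fderiv] at h
  have h := (mul_eq_zero.1 h).resolve_right he
  simp [hGu0, hu0] at h
  linear_combination h

/-! ### Holomorphy of directional derivatives -/

/-- The directional derivatives of a holomorphic map of several variables are holomorphic. -/
theorem differentiableAt_fderiv_apply {E F : Type*} [NormedAddCommGroup E] [NormedSpace ℂ E]
    [FiniteDimensional ℂ E] [NormedAddCommGroup F] [NormedSpace ℂ F] [FiniteDimensional ℂ F]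
    {f : E → F} {x : E} (hf : ∀ᶠ y in 𝓝 x, DifferentiableAt ℂ f y) (u : E) :
    DifferentiableAt ℂ (fun y => fderiv ℂ f y u) x := by
  have : CompleteSpace F := FiniteDimensional.complete ℂ F
  let _ : MeasurableSpace E := borel E
  have : BorelSpace E := ⟨rfl⟩
  have : ProperSpace E := FiniteDimensional.proper ℂ E
  obtain ⟨R, hR, hfR⟩ : ∃ R > 0, ∀ y ∈ Metric.ball x R,
      DifferentiableAt ℂ f y ∧ ‖f y - f x‖ ≤ 1 := by
    obtain ⟨R, hR, h⟩ := Metric.eventually_nhds_iff_ball.1 (hf.and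
      (hf.self_of_nhds.continuousAt.eventually (Metric.ball_mem_nhds _ one_pos)))
    exact ⟨R, hR, fun y hy => ⟨(h y hy).1, by
      have := (h y hy).2; rw [dist_eq_norm] at this; exact this.le⟩⟩
  have hd : ∀ y ∈ Metric.ball x R, DifferentiableAt ℂ f y := fun y hy => (hfR y hy).1
  have hbound : ∀ y ∈ Metric.ball x (R / 2), ‖fderiv ℂ f y‖ ≤ 2 / (R / 2) := by
    intro y hy
    have hsub : Metric.ball y (R / 2) ⊆ Metric.ball x R :=
      Metric.ball_subset_ball' (by have := Metric.mem_ball.1 hy; linarith)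
    refine Complex.norm_fderiv_le_div_of_mapsTo_ball
      (fun z hz => (hd z (hsub hz)).differentiableWithinAt) (fun z hz => ?_) (by positivity)
    rw [Metric.mem_closedBall, dist_eq_norm]
    have h1 := (hfR z (hsub hz)).2
    have h2 := (hfR y (hsub (Metric.mem_ball_self (by positivity)))).2
    calc ‖f z - f y‖ = ‖(f z - f x) - (f y - f x)‖ := by congr 1; abel
      _ ≤ _ := norm_sub_le _ _
      _ ≤ 2 := by linarith
  obtain ⟨r, hr, hru⟩ : ∃ r > 0, r * ‖u‖ < R / 4 := by
    refine ⟨R / (4 * (‖u‖ + 1)), by positivity, ?_⟩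
    rw [div_mul_eq_mul_div, div_lt_div_iff₀ (by positivity) (by positivity)]
    nlinarith [norm_nonneg u]
  have hmem : ∀ y ∈ Metric.ball x (R / 4), ∀ s : ℂ, ‖s‖ ≤ r →
      y + s • u ∈ Metric.ball x (R / 2) := by
    intro y hy s hs
    rw [Metric.mem_ball, dist_eq_norm] at hy ⊢
    calc ‖y + s • u - x‖ = ‖(y - x) + s • u‖ := by congr 1; abel
      _ ≤ ‖y - x‖ + ‖s • u‖ := norm_add_le _ _
      _ = ‖y - x‖ + ‖s‖ * ‖u‖ := by rw [norm_smul]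
      _ < R / 2 := by nlinarith [mul_le_mul_of_nonneg_right hs (norm_nonneg u)]
  have hhalf : Metric.ball x (R / 2) ⊆ Metric.ball x R :=
    Metric.ball_subset_ball (by linarith)
  have hcirc : ∀ θ : ℝ, ‖circleMap 0 r θ‖ ≤ r := fun θ => by simp [abs_of_pos hr]
  set k : ℝ → ℂ := fun θ => deriv (circleMap 0 r) θ * (1 / (circleMap 0 r θ) ^ 2) with hk
  have hkc : Continuous k := by
    refine Continuous.mul ?_ (Continuous.div continuous_const (by fun_prop) fun θ => ?_)
    · rw [funext (deriv_circleMap 0 r)]; fun_prop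
    · exact pow_ne_zero 2 (circleMap_ne_center hr.ne')
  -- Cauchy's formula on the discs `s ↦ y + s • u` expresses the derivative as an integral of `f`,
  -- which can be differentiated under the integral sign; the Cauchy estimate `hbound` supplies the
  -- domination.
  have hcauchy : ∀ y ∈ Metric.ball x (R / 4), fderiv ℂ f y u =
      (2 * Real.pi * Complex.I : ℂ)⁻¹ •
        ∫ θ in (0 : ℝ)..2 * Real.pi, k θ • f (y + circleMap 0 r θ • u) := by
    intro y hy
    have hdl : ∀ s : ℂ, ‖s‖ ≤ r → DifferentiableAt ℂ (fun s : ℂ => f (y + s • u)) s := by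
      intro s hs
      exact (hd _ (hhalf (hmem y hy s hs))).comp s (by fun_prop)
    have h1 := DifferentiableOn.deriv_eq_smul_circleIntegral (c := 0) hr
      (f := fun s : ℂ => f (y + s • u))
      (fun s hs => (hdl s (by simpa using hs)).differentiableWithinAt)
    have h2 : deriv (fun s : ℂ => f (y + s • u)) 0 = fderiv ℂ f y u := by
      have hl : HasDerivAt (fun s : ℂ => y + s • u) u 0 := by
        simpa using ((hasDerivAt_id (0 : ℂ)).smul_const u).const_add y
      have h3 : HasFDerivAt f (fderiv ℂ f y) (y + (0 : ℂ) • u) := by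
        rw [zero_smul, add_zero]
        exact (hd y (Metric.ball_subset_ball (by linarith) hy)).hasFDerivAt
      exact (h3.comp_hasDerivAt (0 : ℂ) hl).deriv
    rw [← h2, eq_inv_smul_iff₀ Complex.two_pi_I_ne_zero, ← h1, circleIntegral]
    simp only [hk, smul_smul, sub_zero]
  have hcont : ∀ y ∈ Metric.ball x (R / 4),
      Continuous fun θ : ℝ => k θ • f (y + circleMap 0 r θ • u) := by
    intro y hy
    refine hkc.smul (continuous_iff_continuousAt.2 fun θ => ?_)
    refine ContinuousAt.comp (g := f) (hd _ (hhalf (hmem y hy _ (hcirc θ)))).continuousAt ?_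
    fun_prop
  have hball : Metric.ball x (R / 4) ∈ 𝓝 x := Metric.ball_mem_nhds x (by positivity)
  obtain ⟨C, hC⟩ : ∃ C, ∀ θ ∈ Set.uIcc (0 : ℝ) (2 * Real.pi), ‖k θ‖ ≤ C :=
    isCompact_uIcc.exists_bound_of_continuousOn hkc.continuousOn
  have hmeas : MeasureTheory.AEStronglyMeasurable
      (fun θ : ℝ => k θ • fderiv ℂ f (x + circleMap 0 r θ • u))
      (MeasureTheory.volume.restrict (Set.uIoc 0 (2 * Real.pi))) := by
    refine (hkc.aestronglyMeasurable).smul ?_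
    let _ : MeasurableSpace (E →L[ℂ] F) := borel _
    have : BorelSpace (E →L[ℂ] F) := ⟨rfl⟩
    have : ProperSpace (E →L[ℂ] F) := FiniteDimensional.proper ℂ _
    have : Continuous fun θ : ℝ => x + circleMap 0 r θ • u := by fun_prop
    exact ((measurable_fderiv ℂ f).comp this.measurable).aestronglyMeasurable
  have hint := intervalIntegral.hasFDerivAt_integral_of_dominated_of_fderiv_le
    (𝕜 := ℂ) (μ := MeasureTheory.volume) (a := 0) (b := 2 * Real.pi)
    (F := fun y θ => k θ • f (y + circleMap 0 r θ • u))
    (F' := fun y θ => k θ • fderiv ℂ f (y + circleMap 0 r θ • u))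
    (bound := fun _ => C * (2 / (R / 2))) (x₀ := x) hball
    (by filter_upwards [hball] with y hy; exact (hcont y hy).aestronglyMeasurable)
    ((hcont x (Metric.mem_ball_self (by positivity))).intervalIntegrable _ _) hmeas
    (Eventually.of_forall fun θ hθ y hy => by
      rw [norm_smul]
      exact mul_le_mul (hC θ (Set.uIoc_subset_uIcc hθ)) (hbound _ (hmem y hy _ (hcirc θ)))
        (norm_nonneg _) ((norm_nonneg _).trans (hC θ (Set.uIoc_subset_uIcc hθ))))
    (by simp)
    (Eventually.of_forall fun θ _ y hy => by
      refine HasFDerivAt.const_smul ?_ _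
      have h := (hd _ (hhalf (hmem y hy _ (hcirc θ)))).hasFDerivAt
      exact h.comp y ((hasFDerivAt_id y).add_const _))
  refine (hint.differentiableAt.const_smul (2 * Real.pi * Complex.I : ℂ)⁻¹).congr_of_eventuallyEq ?_
  filter_upwards [hball] with y hy using hcauchy y hy

/-! ### Passing from the real points `(Z, Z̄)` to independent variables -/

section Complexification

variable {V : Type*} [NormedAddCommGroup V] [NormedSpace ℂ V] [StarAddMonoid V]
  [NormedStarGroup V] [StarModule ℂ V]

/-- A holomorphic function on `V × V` that vanishes on the totally real subspace `{(Z, Z̄)}`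
vanishes identically near `0`. -/
theorem eventually_eq_zero_of_eq_zero_on_real {f : V × V → ℂ}
    (hf : ∀ᶠ p in 𝓝 (0 : V × V), DifferentiableAt ℂ f p)
    (h0 : ∀ᶠ Z in 𝓝 (0 : V), f (Z, star Z) = 0) :
    ∀ᶠ p in 𝓝 (0 : V × V), f p = 0 := by
  obtain ⟨R₁, hR₁, hfR₁⟩ := Metric.eventually_nhds_iff_ball.1 hf
  obtain ⟨R₂, hR₂, h0R₂⟩ := Metric.eventually_nhds_iff_ball.1 h0
  obtain ⟨R, hR, hle₁, hle₂⟩ : ∃ R > 0, R ≤ R₁ ∧ R ≤ R₂ :=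
    ⟨min R₁ R₂, lt_min hR₁ hR₂, min_le_left _ _, min_le_right _ _⟩
  have hfR : ∀ p ∈ Metric.ball 0 R, DifferentiableAt ℂ f p := fun p hp =>
    hfR₁ p (Metric.ball_subset_ball hle₁ hp)
  have h0R : ∀ Z ∈ Metric.ball 0 R, f (Z, star Z) = 0 := fun Z hZ =>
    h0R₂ Z (Metric.ball_subset_ball hle₂ hZ)
  filter_upwards [Metric.ball_mem_nhds (0 : V × V) (show 0 < R / 3 by positivity)] with p hp
  obtain ⟨Z, χ⟩ := p
  rw [mem_ball_zero_iff, Prod.norm_mk, max_lt_iff] at hp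
  obtain ⟨hZ, hχ⟩ := hp
  -- The complex line `s ↦ (A + s B, A* + s B*)` consists of points `(Z, Z̄)` for real `s` and
  -- passes through the given `(Z, χ)` at `s = i`. The one-variable identity theorem on the disc of
  -- radius `2` transports the vanishing.
  set A : V := (1 / 2 : ℂ) • (Z + star χ) with hA
  set B : V := (-Complex.I / 2 : ℂ) • (Z - star χ) with hB
  have hAn : ‖A‖ < R / 3 := by
    rw [hA, norm_smul]
    have := norm_add_le Z (star χ)
    rw [norm_star] at this
    norm_num
    linarith
  have hBn : ‖B‖ < R / 3 := by
    rw [hB, norm_smul]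
    have := norm_sub_le Z (star χ)
    rw [norm_star] at this
    norm_num
    linarith
  have hI : A + Complex.I • B = Z := by
    rw [hA, hB, smul_smul, show Complex.I * (-Complex.I / 2) = 1 / 2 by
      rw [mul_div_assoc', mul_neg, Complex.I_mul_I, neg_neg], ← smul_add]
    rw [show Z + star χ + (Z - star χ) = (2 : ℂ) • Z by rw [two_smul]; abel, smul_smul]
    norm_num
  have hI' : star A + Complex.I • star B = χ := by
    rw [hA, hB, star_smul, star_smul, smul_smul,
      show Complex.I * star (-Complex.I / 2 : ℂ) = -(1 / 2) by
        simp only [neg_div, star_neg, star_div₀, Complex.star_def, Complex.conj_I, star_ofNat,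
          neg_neg, mul_div_assoc', Complex.I_mul_I], star_add, star_sub, star_star]
    rw [show star (1 / 2 : ℂ) = 1 / 2 by simp, neg_smul, ← sub_eq_add_neg, ← smul_sub]
    rw [show star Z + χ - (star Z - χ) = (2 : ℂ) • χ by rw [two_smul]; abel, smul_smul]
    norm_num
  clear_value A B
  have hmem : ∀ s ∈ Metric.ball (0 : ℂ) 2, (A + s • B, star A + s • star B) ∈
      Metric.ball (0 : V × V) R := by
    intro s hs
    rw [mem_ball_zero_iff] at hs ⊢
    have hsB : ‖s‖ * ‖B‖ ≤ 2 * (R / 3) :=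
      mul_le_mul hs.le hBn.le (norm_nonneg _) zero_le_two
    rw [Prod.norm_mk, max_lt_iff]
    constructor
    · refine (norm_add_le _ _).trans_lt ?_
      rw [norm_smul]; linarith
    · refine (norm_add_le _ _).trans_lt ?_
      rw [norm_smul, norm_star, norm_star]; linarith
  set g : ℂ → ℂ := fun s => f (A + s • B, star A + s • star B) with hg
  have hgd : DifferentiableOn ℂ g (Metric.ball 0 2) := fun s hs =>
    (DifferentiableAt.comp (g := f) s (hfR _ (hmem s hs)) (by fun_prop)).differentiableWithinAt
  have hreal : ∀ᶠ t : ℝ in 𝓝[≠] 0, g t = 0 := by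
    filter_upwards [nhdsWithin_le_nhds (Metric.ball_mem_nhds (0 : ℝ) two_pos)] with t ht
    have hm := hmem t (by simpa using ht)
    rw [mem_ball_zero_iff, Prod.norm_mk, max_lt_iff] at hm
    have h1 := h0R (A + (t : ℂ) • B) (mem_ball_zero_iff.2 hm.1)
    rwa [star_add, star_smul, show star (t : ℂ) = t from Complex.conj_ofReal t] at h1
  have hto : Tendsto (fun t : ℝ => (t : ℂ)) (𝓝[≠] 0) (𝓝[≠] 0) := by
    refine tendsto_nhdsWithin_of_tendsto_nhds_of_eventually_within _ ?_ ?_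
    · simpa using (Complex.continuous_ofReal.tendsto 0).mono_left nhdsWithin_le_nhds
    · filter_upwards [self_mem_nhdsWithin] with t ht
      simpa using ht
  have h1 := (hgd.analyticOnNhd Metric.isOpen_ball).eqOn_zero_of_preconnected_of_frequently_eq_zero
    (convex_ball (0 : ℂ) 2).isPreconnected (Metric.mem_ball_self two_pos)
    (hto.frequently hreal.frequently)
  have h2 := h1 (show Complex.I ∈ Metric.ball (0 : ℂ) 2 by simp)
  simpa [hg, hI, hI'] using h2

/-- Reality of `Z ↦ ρ(Z, Z̄)` means that `ρ` is hermitian symmetric. -/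
theorem eventually_star_swap_eq {ρ : V × V → ℂ}
    (hρ : ∀ᶠ p in 𝓝 (0 : V × V), DifferentiableAt ℂ ρ p)
    (hreal : ∀ᶠ Z in 𝓝 (0 : V), (ρ (Z, star Z)).im = 0) :
    ∀ᶠ p in 𝓝 (0 : V × V), ρ (star p.2, star p.1) = star (ρ p) := by
  have hc : Tendsto (fun p : V × V => (star p.2, star p.1)) (𝓝 0) (𝓝 0) := by
    have : Continuous fun p : V × V => (star p.2, star p.1) := by fun_prop
    simpa [Prod.mk_zero_zero] using this.tendsto 0
  have h := eventually_eq_zero_of_eq_zero_on_real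
    (f := fun p : V × V => ρ p - star (ρ (star p.2, star p.1))) ?_ ?_
  · filter_upwards [h] with p hp
    rw [sub_eq_zero.1 hp, star_star]
  · filter_upwards [hρ, hc.eventually hρ] with p h1 h2
    refine h1.sub ?_
    have h3 : DifferentiableAt ℂ (fun q : V × V => ρ (q.2, q.1)) (star p) :=
      DifferentiableAt.comp (g := ρ) (star p) h2 (by fun_prop)
    have h4 := h3.star_star
    rw [star_star] at h4
    exact h4
  · filter_upwards [hreal] with Z hZ
    simp only [star_star, sub_eq_zero]
    exact (Complex.conj_eq_iff_im.2 hZ).symm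

/-- The conjugating swap fixes the origin, so differentiating the hermitian symmetry there
interchanges the two partial differentials up to conjugation. -/
theorem fderiv_snd_star_eq {ρ : V × V → ℂ} (hρ : DifferentiableAt ℂ ρ 0)
    (hsym : ∀ᶠ p in 𝓝 (0 : V × V), ρ (star p.2, star p.1) = star (ρ p)) (v : V) :
    fderiv ℂ ρ 0 (0, star v) = star (fderiv ℂ ρ 0 (v, 0)) := by
  have h1 : HasFDerivAt (fun q : V × V => ρ (q.2, q.1)) _ (star (0 : V × V)) :=
    HasFDerivAt.comp (g := ρ) (g' := fderiv ℂ ρ 0) (star (0 : V × V))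
      (by simpa [Prod.mk_zero_zero] using hρ.hasFDerivAt)
      ((ContinuousLinearMap.snd ℂ V V).prod (ContinuousLinearMap.fst ℂ V V)).hasFDerivAt
  have h2 := h1.star_star
  rw [star_star] at h2
  have h3 : HasFDerivAt ρ _ (0 : V × V) := h2.congr_of_eventuallyEq (by
    filter_upwards [hsym] with p hp
    simp [hp])
  have h4 := DFunLike.congr_fun (h3.unique hρ.hasFDerivAt) (0, star v)
  simpa using h4.symm

/-- A holomorphic function that vanishes on the real hypersurface `{ρ(Z, Z̄) = 0}` vanishes on its
complexification `{ρ(Z, χ) = 0}`. -/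
theorem eventually_vanish_of_vanish_on_real [CompleteSpace V] {ρ G : V × V → ℂ} {v : V}
    (hρ : AnalyticAt ℂ ρ 0) (hρ0 : ρ 0 = 0) (hreal : ∀ᶠ Z in 𝓝 (0 : V), (ρ (Z, star Z)).im = 0)
    (hv : fderiv ℂ ρ 0 (v, 0) ≠ 0)
    (hG : ∀ᶠ p in 𝓝 (0 : V × V), DifferentiableAt ℂ G p)
    (hvan : ∀ᶠ Z in 𝓝 (0 : V), ρ (Z, star Z) = 0 → G (Z, star Z) = 0) :
    ∀ᶠ p in 𝓝 (0 : V × V), ρ p = 0 → G p = 0 := by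
  have hsym := eventually_star_swap_eq
    (hρ.eventually_analyticAt.mono fun p h => h.differentiableAt) hreal
  set a := fderiv ℂ ρ 0 (v, 0) with ha
  -- This scaling makes the derivative along `(w, 0)` equal to `|a|²`, so the real direction `(w,
  -- w̄)` has derivative `2|a|² ≠ 0`.
  set w : V := star a • v with hw
  set e : V × V := (w, star w) with he
  have hee : fderiv ℂ ρ 0 e ≠ 0 := by
    have h1 : fderiv ℂ ρ 0 (w, 0) = star a * a := by
      rw [hw, show (star a • v, (0 : V)) = star a • (v, (0 : V)) by simp, map_smul, smul_eq_mul]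
    have h2 := fderiv_snd_star_eq hρ.differentiableAt hsym w
    have h3 : e = (w, 0) + (0, star w) := by simp [he]
    rw [h3, map_add, h2, h1, star_mul, star_star, ← two_mul]
    exact mul_ne_zero two_ne_zero (mul_ne_zero (star_ne_zero.2 hv) hv)
  obtain ⟨τ, hτ, hτ0, hz, huniq⟩ := exists_implicit_along hρ.contDiffAt hρ0 hee
  have hτc : Tendsto τ (𝓝 0) (𝓝 0) := by simpa [hτ0] using hτ.continuousAt.tendsto
  have hφ : Tendsto (fun x => x + τ x • e) (𝓝 0) (𝓝 0) := by
    have := (tendsto_id (x := 𝓝 (0 : V × V))).add (hτc.smul_const e)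
    simpa using this
  have hdiag : Tendsto (fun Z : V => (Z, star Z)) (𝓝 0) (𝓝 (0 : V × V)) := by
    have : Continuous fun Z : V => (Z, star Z) := by fun_prop
    simpa [Prod.mk_zero_zero] using this.tendsto 0
  have h := eventually_eq_zero_of_eq_zero_on_real (f := fun x => G (x + τ x • e)) ?_ ?_
  · have h1 : Tendsto (fun p : V × V => (p, (0 : ℂ))) (𝓝 0) (𝓝 (0, 0)) :=
      tendsto_id.prodMk_nhds tendsto_const_nhds
    filter_upwards [h, h1.eventually huniq] with p hp hp' h0
    have : τ p = 0 := hp' (by simpa using h0)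
    simpa [this] using hp
  · have hτd : ∀ᶠ x in 𝓝 0, DifferentiableAt ℂ τ x :=
      (hτ.eventually (by simp)).mono fun x hx => hx.differentiableAt one_ne_zero
    filter_upwards [hφ.eventually hG, hτd] with x hx hx'
    exact DifferentiableAt.comp (g := G) x hx (differentiableAt_id.add (hx'.smul_const e))
  · have hpair : Tendsto (fun Z : V => ((Z, star Z), star (τ (Z, star Z)))) (𝓝 0)
        (𝓝 ((0 : V × V), (0 : ℂ))) := by
      refine hdiag.prodMk_nhds ?_
      simpa only [star_zero, Function.comp_def] using (continuous_star.tendsto (0 : ℂ)).comp (hτc.comp hdiag)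
    have hre : Tendsto (fun Z : V => Z + τ (Z, star Z) • w) (𝓝 0) (𝓝 0) := by
      have := (tendsto_id (x := 𝓝 (0 : V))).add ((hτc.comp hdiag).smul_const w)
      simpa using this
    filter_upwards [hdiag.eventually hz, hpair.eventually huniq,
      (hφ.comp hdiag).eventually hsym, hre.eventually hvan] with Z h1 h2 h3 h4
    -- By hermitian symmetry the conjugate of `τ` solves the same implicit equation, so uniqueness
    -- makes `τ` real here and the projected point stays of the form `(Z, Z̄)`.
    have h5 : star (τ (Z, star Z)) = τ (Z, star Z) := by
      refine (h2 ?_).symm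
      have h6 := h3
      simp only [Function.comp_apply, h1, star_zero] at h6
      simpa [he] using h6
    have h7 : (Z, star Z) + τ (Z, star Z) • e =
        (Z + τ (Z, star Z) • w, star (Z + τ (Z, star Z) • w)) := by
      simp [he, h5]
    rw [h7] at h1 ⊢
    exact h4 h1

end Complexification

/-! ### Proportionality of derivatives along the complexified hypersurface -/

theorem fderiv_prodMk_left {V : Type*} [NormedAddCommGroup V] [NormedSpace ℂ V] {g : V × V → ℂ}
    {Z χ : V} (hg : DifferentiableAt ℂ g (Z, χ)) (v : V) :
    fderiv ℂ (fun Z => g (Z, χ)) Z v = fderiv ℂ g (Z, χ) (v, 0) := by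
  have h : HasFDerivAt (fun Z => g (Z, χ)) _ Z :=
    HasFDerivAt.comp (g := g) (f := fun Z => (Z, χ)) Z hg.hasFDerivAt (hasFDerivAt_prodMk_left Z χ)
  rw [h.fderiv]
  simp

/-- Comparison of first and second derivatives, on the Segre varieties through `0`, of a function
`ρ` and of a pairing `B(χ)(f(Z)) + c(χ)` that vanishes on the real hypersurface `{ρ(Z, Z̄) = 0}`. -/
theorem eventually_exists_proportional {V Y : Type*} [NormedAddCommGroup V] [NormedSpace ℂ V]
    [StarAddMonoid V] [NormedStarGroup V] [StarModule ℂ V] [FiniteDimensional ℂ V]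
    [NormedAddCommGroup Y] [NormedSpace ℂ Y] [FiniteDimensional ℂ Y]
    {ρ : V × V → ℂ} {f : V → Y} {B : V → Y →L[ℂ] ℂ} {c : V → ℂ} {e u₀ : V}
    (hρ : AnalyticAt ℂ ρ 0) (hρ0 : ρ 0 = 0) (hreal : ∀ᶠ Z in 𝓝 (0 : V), (ρ (Z, star Z)).im = 0)
    (he : fderiv ℂ ρ 0 (e, 0) ≠ 0)
    (hf : ∀ᶠ Z in 𝓝 (0 : V), DifferentiableAt ℂ f Z)
    (hB : ∀ᶠ Z in 𝓝 (0 : V), DifferentiableAt ℂ B Z)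
    (hc : ∀ᶠ Z in 𝓝 (0 : V), DifferentiableAt ℂ c Z)
    (hvan : ∀ᶠ Z in 𝓝 (0 : V), ρ (Z, star Z) = 0 → B (star Z) (f Z) + c (star Z) = 0)
    (hu₀ : B 0 (fderiv ℂ f 0 u₀) ≠ 0) :
    ∀ᶠ χ in 𝓝 (0 : V), ρ (0, χ) = 0 → ∃ a b : ℂ, a ≠ 0 ∧ b ≠ 0 ∧
      (∀ u, B χ (fderiv ℂ f 0 u) * b = a * fderiv ℂ ρ (0, χ) (u, 0)) ∧
      ∀ u v, fderiv ℂ ρ (0, χ) (u, 0) = 0 → fderiv ℂ ρ (0, χ) (v, 0) = 0 →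
        B χ (fderiv ℂ (fun Z => fderiv ℂ f Z u) 0 v) * b =
          a * fderiv ℂ (fun q => fderiv ℂ ρ q (u, 0)) (0, χ) (v, 0) := by
  have : CompleteSpace V := FiniteDimensional.complete ℂ V
  set G : V × V → ℂ := fun q => B q.2 (f q.1) + c q.2 with hG
  have hfst : Tendsto Prod.fst (𝓝 (0 : V × V)) (𝓝 (0 : V)) := continuous_fst.tendsto 0
  have hsnd : Tendsto Prod.snd (𝓝 (0 : V × V)) (𝓝 (0 : V)) := continuous_snd.tendsto 0
  have hpair : ∀ (g : V → Y) (q : V × V), DifferentiableAt ℂ g q.1 → DifferentiableAt ℂ B q.2 →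
      DifferentiableAt ℂ (fun q : V × V => B q.2 (g q.1)) q := fun g q hg hB =>
    (hB.comp q differentiableAt_snd).clm_apply (hg.comp q differentiableAt_fst)
  have hGd : ∀ᶠ q in 𝓝 (0 : V × V), DifferentiableAt ℂ G q := by
    filter_upwards [hfst.eventually hf, hsnd.eventually hB, hsnd.eventually hc] with q h1 h2 h3
    exact (hpair f q h1 h2).add (h3.comp q differentiableAt_snd)
  have hderiv : ∀ (g : V → Y) (q : V × V) (v : V), DifferentiableAt ℂ g q.1 →
      DifferentiableAt ℂ B q.2 →
      fderiv ℂ (fun q : V × V => B q.2 (g q.1)) q (v, 0) = B q.2 (fderiv ℂ g q.1 v) := by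
    intro g q v hg hB
    have h1 := fderiv_prodMk_left (Z := q.1) (χ := q.2) (hpair g q hg hB) v
    rw [Prod.mk.eta] at h1
    rw [← h1, HasFDerivAt.fderiv (f := fun Z => B q.2 (g Z))
      ((B q.2).hasFDerivAt.comp q.1 hg.hasFDerivAt)]
    simp
  have hGu : ∀ᶠ q in 𝓝 (0 : V × V), ∀ u, fderiv ℂ G q (u, 0) = B q.2 (fderiv ℂ f q.1 u) := by
    filter_upwards [hfst.eventually hf, hsnd.eventually hB, hsnd.eventually hc] with q h1 h2 h3 u
    have h4 : HasFDerivAt (fun q : V × V => c q.2) _ q :=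
      HasFDerivAt.comp (g := c) q h3.hasFDerivAt hasFDerivAt_snd
    rw [← hderiv f q u h1 h2, hG, fderiv_fun_add (hpair f q h1 h2) h4.differentiableAt]
    simp [h4.fderiv]
  have hvanG := eventually_vanish_of_vanish_on_real hρ hρ0 hreal he hGd hvan
  have hχ : Tendsto (fun χ : V => ((0 : V), χ)) (𝓝 0) (𝓝 (0 : V × V)) :=
    tendsto_const_nhds.prodMk_nhds tendsto_id
  have hρe : ∀ᶠ q in 𝓝 (0 : V × V), fderiv ℂ ρ q (e, 0) ≠ 0 :=
    (hρ.fderiv.differentiableAt.clm_apply (differentiableAt_const _)).continuousAt.eventually_ne he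
  -- If the derivative of `G` along `e` vanished, proportionality would force every first
  -- `Z`-derivative of `G` at the origin to vanish, contradicting `hu₀`.
  have hBe : B 0 (fderiv ℂ f 0 e) ≠ 0 := by
    intro h0
    have h1 := fderiv_mul_eq_of_vanish hρ.contDiffAt hρ0 he hGd.self_of_nhds hvanG (u₀, 0)
    rw [hGu.self_of_nhds, hGu.self_of_nhds] at h1
    simp only [Prod.fst_zero, Prod.snd_zero, h0, zero_mul] at h1
    exact (mul_ne_zero hu₀ he) h1
  have hBe' : ∀ᶠ χ in 𝓝 (0 : V), B χ (fderiv ℂ f 0 e) ≠ 0 :=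
    (hB.self_of_nhds.clm_apply (differentiableAt_const _)).continuousAt.eventually_ne hBe
  filter_upwards [hBe', hχ.eventually hρe, hχ.eventually hGu.eventually_nhds,
    hχ.eventually hGd.eventually_nhds, hχ.eventually hvanG.eventually_nhds,
    hχ.eventually hρ.eventually_analyticAt, hB] with χ h1 h2 h3 h4 h5 h6 h7 h8
  refine ⟨B χ (fderiv ℂ f 0 e), fderiv ℂ ρ (0, χ) (e, 0), h1, h2, fun u => ?_, fun u v hu hv => ?_⟩
  · have h9 := fderiv_mul_eq_of_vanish h6.contDiffAt h8 h2 h4.self_of_nhds h5 (u, 0)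
    rwa [h3.self_of_nhds, h3.self_of_nhds] at h9
  · have heq : ∀ w, (fun q => fderiv ℂ G q (w, 0)) =ᶠ[𝓝 (0, χ)]
        fun q => B q.2 (fderiv ℂ f q.1 w) := fun w => h3.mono fun q hq => hq w
    have hd : ∀ w, DifferentiableAt ℂ (fun q => fderiv ℂ G q (w, 0)) (0, χ) := fun w =>
      (hpair (fun Z => fderiv ℂ f Z w) (0, χ) (differentiableAt_fderiv_apply hf w)
        h7).congr_of_eventuallyEq (heq w)
    have h9 := fderiv_fderiv_mul_eq_of_vanish h6 h8 h2 h4 (hd u) (hd e) h5 hu hv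
    rwa [(heq u).fderiv_eq, h3.self_of_nhds,
      hderiv (fun Z => fderiv ℂ f Z u) (0, χ) v (differentiableAt_fderiv_apply hf u) h7] at h9

/-! ### Multiindices of weight at most two as compositions of operators -/

theorem List.foldr_iterate_eq_of_sum_eq_zero {ι X : Type*} (D : ι → X → X) (α : ι → ℕ)
    (l : List ι) (h : (l.map α).sum = 0) (x : X) :
    l.foldr (fun i g => (D i)^[α i] g) x = x := by
  induction l with
  | nil => simp
  | cons a l ih =>
    rw [List.map_cons, List.sum_cons, Nat.add_eq_zero_iff] at h
    rw [List.foldr_cons, ih h.2, h.1, Function.iterate_zero, id]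

theorem List.exists_foldr_iterate_eq_of_sum_eq_one {ι X : Type*} (D : ι → X → X) (α : ι → ℕ)
    (l : List ι) (h : (l.map α).sum = 1) :
    ∃ i, α i ≠ 0 ∧ ∀ x, l.foldr (fun i g => (D i)^[α i] g) x = D i x := by
  induction l with
  | nil => simp at h
  | cons a l ih =>
    rw [List.map_cons, List.sum_cons] at h
    rcases Nat.eq_zero_or_pos (α a) with ha | ha
    · obtain ⟨i, hi, hx⟩ := ih (by omega)
      exact ⟨i, hi, fun x => by rw [List.foldr_cons, ha, hx, Function.iterate_zero, id]⟩
    · refine ⟨a, ha.ne', fun x => ?_⟩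
      rw [List.foldr_cons, List.foldr_iterate_eq_of_sum_eq_zero D α l (by omega), show α a = 1 by omega, Function.iterate_one]

/-- The weight sits either in one entry or in two entries of the list. The fold already fixes the
order of the operators, so no commutation of partial derivatives is needed. -/
theorem List.exists_foldr_iterate_eq_of_sum_eq_two {ι X : Type*} (D : ι → X → X) (α : ι → ℕ)
    (l : List ι) (h : (l.map α).sum = 2) :
    ∃ i j, α i ≠ 0 ∧ α j ≠ 0 ∧ ∀ x, l.foldr (fun i g => (D i)^[α i] g) x = D i (D j x) := by
  induction l with
  | nil => simp at h
  | cons a l ih =>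
    rw [List.map_cons, List.sum_cons] at h
    obtain ha | ha | ha : α a = 0 ∨ α a = 1 ∨ α a = 2 := by omega
    · obtain ⟨i, j, hi, hj, hx⟩ := ih (by omega)
      exact ⟨i, j, hi, hj, fun x => by rw [List.foldr_cons, ha, hx, Function.iterate_zero, id]⟩
    · obtain ⟨j, hj, hx⟩ := List.exists_foldr_iterate_eq_of_sum_eq_one D α l (by omega)
      exact ⟨a, j, by omega, hj, fun x => by rw [List.foldr_cons, ha, hx, Function.iterate_one]⟩
    · refine ⟨a, a, by omega, by omega, fun x => ?_⟩
      rw [List.foldr_cons, List.foldr_iterate_eq_of_sum_eq_zero D α l (by omega), ha]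
      rfl

namespace CRHyp

theorem exists_dzMulti_eq_dz_dz {n : ℕ} {α : Fin n → ℕ} (hα : ∑ i, α i = 2) :
    ∃ i j, α i ≠ 0 ∧ α j ≠ 0 ∧ ∀ f : Space n → ℂ, dzMulti α f = dz i (dz j f) :=
  List.exists_foldr_iterate_eq_of_sum_eq_two _ α _ (by
    rw [← hα, ← List.ofFn_eq_map, List.sum_ofFn])

/-! ### Polarization of the hyperquadric -/

namespace Hyperquadric

variable {N : ℕ} (Q : Hyperquadric N)

/-- The polarized defining function `v ↦ w(v) / 2i - ∑ A_{jk} y_j z_k(v)`. -/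
def polar (y : (Fin N → ℂ) × ℂ) : (Fin N → ℂ) × ℂ →L[ℂ] ℂ :=
  (2 * Complex.I)⁻¹ • ContinuousLinearMap.snd ℂ (Fin N → ℂ) ℂ -
    ∑ k, (∑ j, y.1 j * Q.form j k) •
      (ContinuousLinearMap.proj k).comp (ContinuousLinearMap.fst ℂ (Fin N → ℂ) ℂ)

theorem polar_apply (y v : (Fin N → ℂ) × ℂ) :
    Q.polar y v = (2 * Complex.I)⁻¹ * v.2 - y.1 ⬝ᵥ Q.form.mulVec v.1 := by
  rw [Matrix.dotProduct_mulVec]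
  simp [polar, dotProduct, Matrix.vecMul]

theorem differentiable_polar : Differentiable ℂ Q.polar := by
  unfold polar
  fun_prop

/-- Combines `Im w = (w - w̄) / 2i` with the reality of a hermitian form. The result is affine in
the holomorphic coordinates, with coefficients depending only on the conjugated ones. -/
theorem ofReal_defFun (Z : Fin (N + 1) → ℂ) :
    (Q.defFun Z : ℂ) = Q.polar (star (Q.coord Z)) (Q.coord Z) +
      -((2 * Complex.I)⁻¹ * (star (Q.coord Z)).2) := by
  have h := Q.hermitian.im_star_dotProduct_mulVec_self (Q.coord Z).1
  rw [polar_apply, defFun, Complex.ofReal_sub, Complex.im_eq_sub_conj]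
  have h2 : ((star (Q.coord Z).1 ⬝ᵥ Q.form.mulVec (Q.coord Z).1).re : ℂ) =
      star (Q.coord Z).1 ⬝ᵥ Q.form.mulVec (Q.coord Z).1 :=
    Complex.ext (by simp) (by simpa using h.symm)
  rw [h2, Prod.fst_star, Prod.snd_star, div_eq_inv_mul, Complex.star_def]
  ring

theorem differentiable_defFun : Differentiable ℝ Q.defFun := by
  have h : Differentiable ℝ fun Z => Q.coord Z :=
    (Q.coord.toLinearMap.restrictScalars ℝ).toContinuousLinearMap.differentiable
  have hre : Differentiable ℝ Complex.re := Complex.reCLM.differentiable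
  have him : Differentiable ℝ Complex.im := Complex.imCLM.differentiable
  refine (him.comp h.snd).sub (hre.comp ?_)
  simp only [dotProduct, Matrix.mulVec, Pi.star_apply]
  have h1 : ∀ k, Differentiable ℝ fun Z => (Q.coord Z).1 k := fun k =>
    differentiable_pi.1 h.fst k
  have h2 : ∀ k, Differentiable ℝ fun Z => star ((Q.coord Z).1 k) := fun k => (h1 k).star
  fun_prop

theorem fderiv_defFun (y v : Fin (N + 1) → ℂ) :
    fderiv ℝ Q.defFun y v = 2 * (Q.polar (star (Q.coord y)) (Q.coord v)).re := by
  have hl : HasDerivAt (fun t : ℝ => y + t • v) v 0 := by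
    simpa using ((hasDerivAt_id (0 : ℝ)).smul_const v).const_add y
  have h1 : HasFDerivAt Q.defFun (fderiv ℝ Q.defFun y) (y + (0 : ℝ) • v) := by
    rw [zero_smul, add_zero]
    exact (Q.differentiable_defFun y).hasFDerivAt
  have h2 := h1.comp_hasDerivAt (0 : ℝ) hl
  set a := (Q.coord y).1
  set b := (Q.coord v).1
  have hsymm : (star b ⬝ᵥ Q.form.mulVec a).re = (star a ⬝ᵥ Q.form.mulVec b).re := by
    have h3 : star (star b ⬝ᵥ Q.form.mulVec a) = star a ⬝ᵥ Q.form.mulVec b := by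
      rw [Matrix.star_dotProduct, star_star, Matrix.star_mulVec, Q.hermitian.eq,
        Matrix.dotProduct_mulVec]
    rw [← h3, Complex.star_def, Complex.conj_re]
  -- Along a real line the defining function is a quadratic polynomial; hermitian symmetry merges
  -- its two cross terms into the linear coefficient.
  have hexp : ∀ t : ℝ, Q.defFun (y + t • v) = Q.defFun y +
      t * (2 * (Q.polar (star (Q.coord y)) (Q.coord v)).re) -
        t ^ 2 * (star b ⬝ᵥ Q.form.mulVec b).re := by
    intro t
    have h4 : Q.coord (y + t • v) = Q.coord y + (t : ℂ) • Q.coord v := by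
      rw [map_add, ← map_smul, Complex.coe_smul]
    have h5 : (2 * Complex.I)⁻¹ = -Complex.I / 2 := by
      rw [mul_inv, Complex.inv_I]; ring
    rw [polar_apply, defFun, defFun, h4, h5]
    simp only [Prod.fst_add, Prod.snd_add, Prod.smul_fst, Prod.smul_snd, star_add, star_smul,
      Matrix.mulVec_add, Matrix.mulVec_smul, add_dotProduct, dotProduct_add, smul_dotProduct,
      dotProduct_smul, smul_eq_mul, Complex.star_def, Complex.conj_ofReal, Complex.add_re,
      Complex.add_im, Complex.re_ofReal_mul, Complex.im_ofReal_mul, Prod.fst_star, Complex.sub_re]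
    change _ - (_ + _ * (star b ⬝ᵥ Q.form.mulVec a).re + _) = _
    rw [hsymm]
    have h6 : (-Complex.I / 2 * (Q.coord v).2).re = (Q.coord v).2.im / 2 := by
      rw [neg_div, neg_mul, Complex.neg_re, div_mul_eq_mul_div]
      simp
      ring
    rw [h6]
    ring
  have h7 : HasDerivAt (fun t : ℝ => Q.defFun (y + t • v))
      (2 * (Q.polar (star (Q.coord y)) (Q.coord v)).re) 0 := by
    rw [funext hexp]
    have := (((hasDerivAt_id (0 : ℝ)).mul_const
      (2 * (Q.polar (star (Q.coord y)) (Q.coord v)).re)).const_add (Q.defFun y)).sub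
      (((hasDerivAt_id (0 : ℝ)).pow 2).mul_const (star b ⬝ᵥ Q.form.mulVec b).re)
    simpa [Pi.sub_def] using this
  exact h2.unique h7

/-- A complex subspace that is transversal to the hyperquadric is not annihilated by the
polarized defining function. -/
theorem exists_polar_ne_zero {y : Fin (N + 1) → ℂ} {W : Submodule ℂ (Fin (N + 1) → ℂ)}
    (h : W.restrictScalars ℝ ⊔ Q.tangent y = ⊤) :
    ∃ v ∈ W, Q.polar (star (Q.coord y)) (Q.coord v) ≠ 0 := by
  by_contra! hW
  have hle : W.restrictScalars ℝ ≤ Q.tangent y := fun v hv => by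
    change fderiv ℝ Q.defFun y v = 0
    rw [fderiv_defFun, hW v hv, Complex.zero_re, mul_zero]
  rw [sup_eq_right.2 hle] at h
  -- The direction `(0, i)` changes `Im w'` at unit rate and leaves `h` fixed, so it is never
  -- tangent.
  have h1 : Q.coord.symm (0, Complex.I) ∈ Q.tangent y := h ▸ Submodule.mem_top
  have h2 : fderiv ℝ Q.defFun y (Q.coord.symm (0, Complex.I)) = 0 := h1
  rw [fderiv_defFun, polar_apply] at h2
  simp at h2

end Hyperquadric

end CRHyp

/-! ### Tangent spaces, slices and linear algebra -/

namespace CRHyp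

/-- At the origin, the complex tangent space contains the `z`-space. -/
theorem mem_complexTangent_of_eq_zero {n : ℕ} {ρ : Space n × Space n → ℂ}
    (hρ : DifferentiableAt ℂ ρ 0)
    (hsym : ∀ᶠ p in 𝓝 (0 : Space n × Space n), ρ (star p.2, star p.1) = star (ρ p))
    {v : Space n} (hv : fderiv ℂ ρ 0 (v, 0) = 0) : v ∈ complexTangent ρ := by
  have hmem : ∀ u : Space n, fderiv ℂ ρ 0 (u, 0) = 0 → u ∈ realTangent ρ := by
    intro u hu
    have h1 : HasFDerivAt (fun Z : Space n => (Z, star Z)) _ 0 :=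
      (hasFDerivAt_id (𝕜 := ℝ) (0 : Space n)).prodMk
        ((starL' ℝ : Space n ≃L[ℝ] Space n) : Space n →L[ℝ] Space n).hasFDerivAt
    have h2 : HasFDerivAt (fun Z : Space n => ρ (Z, star Z)) _ 0 :=
      HasFDerivAt.comp (g := ρ) (0 : Space n)
        (by simpa [Prod.mk_zero_zero] using hρ.hasFDerivAt.restrictScalars ℝ) h1
    change fderiv ℝ (fun Z : Space n => ρ (Z, star Z)) 0 u = 0
    have h3 : fderiv ℂ ρ 0 (u, star u) = 0 := by
      rw [show (u, star u) = (u, 0) + (0, star u) by simp, map_add,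
        fderiv_snd_star_eq hρ hsym, hu, star_zero, add_zero]
    rw [h2.fderiv]
    exact h3
  refine ⟨hmem v hv, hmem _ ?_⟩
  rw [show (Complex.I • v, (0 : Space n)) = Complex.I • (v, (0 : Space n)) by simp, map_smul, hv,
    smul_zero]

theorem fderiv_slice {n : ℕ} {ρ : Space n × Space n → ℂ} {Z ζ : Space n}
    (h : DifferentiableAt ℂ ρ (Z, star ζ)) (v : Space n) :
    fderiv ℂ (slice ρ ζ) Z v = fderiv ℂ ρ (Z, star ζ) (v, 0) :=
  fderiv_prodMk_left h v

theorem fderiv_fderiv_slice {n : ℕ} {ρ : Space n × Space n → ℂ} {Z ζ : Space n}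
    (h : AnalyticAt ℂ ρ (Z, star ζ)) (u v : Space n) :
    fderiv ℂ (fun Z => fderiv ℂ (slice ρ ζ) Z u) Z v =
      fderiv ℂ (fun q => fderiv ℂ ρ q (u, 0)) (Z, star ζ) (v, 0) := by
  have hd : DifferentiableAt ℂ (fun q => fderiv ℂ ρ q (u, 0)) (Z, star ζ) :=
    h.fderiv.differentiableAt.clm_apply (differentiableAt_const _)
  rw [← fderiv_prodMk_left hd]
  have hc : Tendsto (fun Z : Space n => (Z, star ζ)) (𝓝 Z) (𝓝 (Z, star ζ)) :=
    tendsto_id.prodMk_nhds tendsto_const_nhds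
  refine DFunLike.congr_fun (EventuallyEq.fderiv_eq ?_) v
  filter_upwards [hc.eventually h.eventually_analyticAt] with Y hY
  exact fderiv_slice hY.differentiableAt u

/-- The affine polynomial with linear part given by the vector `u`. -/
theorem exists_linear_eval_firstDerivs {n : ℕ} (u : Space n) :
    ∃ R : MvPolynomial (Option (Fin n)) ℂ, R.totalDegree ≤ 1 ∧
      ∀ (ρ : Space n × Space n → ℂ) (ζ : Space n),
        MvPolynomial.eval (firstDerivs ρ ζ) R = fderiv ℂ (slice ρ ζ) 0 u := by
  have hdeg : ∀ (a : ℂ) (i : Option (Fin n)),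
      (MvPolynomial.C a * MvPolynomial.X i).totalDegree ≤ 1 := fun a i =>
    (MvPolynomial.totalDegree_mul _ _).trans (by simp)
  refine ⟨∑ i, MvPolynomial.C (u.1 i) * MvPolynomial.X (some i) +
    MvPolynomial.C u.2 * MvPolynomial.X none, ?_, fun ρ ζ => ?_⟩
  · exact (MvPolynomial.totalDegree_add _ _).trans
      (max_le (MvPolynomial.totalDegree_finsetSum_le fun i _ => hdeg _ _) (hdeg _ _))
  · have hu : u = ∑ i, u.1 i • ((Pi.single i 1, 0) : Space n) + u.2 • ((0, 1) : Space n) := by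
      refine Prod.ext ?_ ?_
      · ext j
        simp [Prod.fst_sum, Finset.sum_apply, Pi.single_apply]
      · simp [Prod.snd_sum]
    conv_rhs => rw [hu]
    simp only [map_smul, map_add, map_sum, map_mul, MvPolynomial.eval_C, MvPolynomial.eval_X,
      firstDerivs, dz, dw, smul_eq_mul]

/-- The images in the quotient by `W` outnumber its dimension, hence are linearly dependent. -/
theorem exists_sum_smul_mem_of_finrank_lt {K X ι : Type*} [Field K] [AddCommGroup X] [Module K X]
    [FiniteDimensional K X] [Fintype ι] (W : Submodule K X) (h : ι → X)
    (hW : Module.finrank K X < Fintype.card ι + Module.finrank K W) :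
    ∃ c : ι → K, c ≠ 0 ∧ ∑ j, c j • h j ∈ W := by
  have hdep : ¬ LinearIndependent K fun j => W.mkQ (h j) := fun hli => by
    have h1 := hli.fintype_card_le_finrank
    have h2 := W.finrank_quotient_add_finrank
    omega
  obtain ⟨c, hc, j, hj⟩ := Fintype.not_linearIndependent_iff.1 hdep
  refine ⟨c, fun h0 => hj (by simp [h0]), ?_⟩
  rw [← Submodule.Quotient.mk_eq_zero, ← Submodule.mkQ_apply, map_sum]
  simpa only [map_smul] using hc

end CRHyp

end

/-! ### The relation on the distinguished set -/

theorem corollary7p4 (n m : ℕ) (M : Set (CRHyp.Space n))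
    (ρ : CRHyp.Space n × CRHyp.Space n → ℂ)
    (hρ : CRHyp.IsDefiningFunction ρ M)
    (hρw : CRHyp.dw (CRHyp.slice ρ 0) 0 ≠ 0)
    (hρz : ∀ i : Fin n, CRHyp.dz i (CRHyp.slice ρ 0) 0 = 0)
    (hM : ∃ M' : CRHyp.Hyperquadric (n + m), CRHyp.TransversallyEmbeddable M M')
    (I : Set (Fin n)) (hI : I ≠ Set.univ)
    (α : Fin (m + 1) → Fin n → ℕ)
    (hα : ∀ j, ∑ i, α j i = 2)
    (hsupp : ∀ j, Function.support (α j) ⊆ I) :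
    ∃ (c : Fin (m + 1) → ℂ) (R : MvPolynomial (Option (Fin n)) ℂ),
      c ≠ 0 ∧ R.totalDegree ≤ 1 ∧
      ∀ᶠ ζ in 𝓝 (0 : CRHyp.Space n),
        ζ ∈ CRHyp.distinguished ρ (CRHyp.coordSubspace ρ I) →
          ∑ j, c j * CRHyp.dzMulti (α j) (CRHyp.slice ρ ζ) 0 =
            MvPolynomial.eval (CRHyp.firstDerivs ρ ζ) R := by
  obtain ⟨Q, U, H, hU, hMU, hH, hinj, -, hmaps, htrans⟩ := hM
  have hHd : ∀ᶠ Z in 𝓝 (0 : CRHyp.Space n), DifferentiableAt ℂ H Z :=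
    (hU.eventually_mem (hMU hρ.zero_mem)).mono fun Z hZ => hH.differentiableAt (hU.mem_nhds hZ)
  have hρa : AnalyticAt ℂ ρ 0 := hρ.analytic
  have hρ0 : ρ 0 = 0 := by
    simpa [Prod.mk_zero_zero] using hρ.mem_iff.self_of_nhds.1 hρ.zero_mem
  have hsym := eventually_star_swap_eq
    (hρa.eventually_analyticAt.mono fun p h => h.differentiableAt) hρ.real
  have hslice : ∀ v, fderiv ℂ (CRHyp.slice ρ 0) 0 v = fderiv ℂ ρ 0 (v, 0) := fun v => by
    have h := CRHyp.fderiv_slice (Z := 0) (ζ := 0)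
      (by simpa [Prod.mk_zero_zero] using hρa.differentiableAt) v
    simpa [Prod.mk_zero_zero] using h
  -- the embedding in linear coordinates of the hyperquadric
  set T : (Fin (n + m + 1) → ℂ) ≃L[ℂ] (Fin (n + m) → ℂ) × ℂ := Q.coord.toContinuousLinearEquiv
  set f : CRHyp.Space n → (Fin (n + m) → ℂ) × ℂ := fun Z => T (H Z)
  have hfd : ∀ᶠ Z in 𝓝 (0 : CRHyp.Space n), DifferentiableAt ℂ f Z :=
    hHd.mono fun Z hZ => T.differentiableAt.comp Z hZ
  have hdf : ∀ v, fderiv ℂ f 0 v = T (fderiv ℂ H 0 v) := fun v => by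
    have h : HasFDerivAt f _ 0 := T.hasFDerivAt.comp (0 : CRHyp.Space n)
      hHd.self_of_nhds.hasFDerivAt
    rw [h.fderiv]
    rfl
  have hstar : Tendsto (star : CRHyp.Space n → CRHyp.Space n) (𝓝 0) (𝓝 0) := by
    simpa only [star_zero] using continuous_star.tendsto (0 : CRHyp.Space n)
  have hfs : ∀ᶠ χ in 𝓝 (0 : CRHyp.Space n), DifferentiableAt ℂ (fun χ => star (f (star χ))) χ := by
    filter_upwards [hstar.eventually hfd] with χ hχ
    have := hχ.star_star
    rwa [star_star] at this
  obtain ⟨_, ⟨u₀, rfl⟩, hu₀⟩ := Q.exists_polar_ne_zero (htrans 0 hρ.zero_mem)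
  have key := eventually_exists_proportional (ρ := ρ) (f := f)
    (B := fun χ => Q.polar (star (f (star χ))))
    (c := fun χ => -((2 * Complex.I)⁻¹ * (star (f (star χ))).2)) (e := (0, 1)) (u₀ := u₀)
    hρa hρ0 hρ.real (by rw [← hslice]; exact hρw) hfd
    (hfs.mono fun χ h => Q.differentiable_polar.differentiableAt.comp χ h)
    (hfs.mono fun χ h => (h.snd.const_mul _).neg)
    (by
      filter_upwards [hρ.mem_iff] with Z hZ h
      have h1 : Q.defFun (H Z) = 0 := hmaps (hZ.2 h)
      have h2 := Q.ofReal_defFun (H Z)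
      rw [h1, Complex.ofReal_zero] at h2
      simp only [star_star]
      exact h2.symm)
    (by
      simp only [star_zero, hdf]
      exact hu₀)
  choose i j hi hj hdz using fun k => CRHyp.exists_dzMulti_eq_dz_dz (hα k)
  set E : Fin n → CRHyp.Space n := fun i => (Pi.single i 1, 0)
  -- The count is `n + m + 1 < (m + 1) + (n + 1)`. Both `c` and `u` come from the 2-jet of `f` at
  -- the origin, hence do not depend on `ζ`.
  obtain ⟨c, hc, u, hu⟩ := CRHyp.exists_sum_smul_mem_of_finrank_lt
    (LinearMap.range (fderiv ℂ f 0 : CRHyp.Space n →ₗ[ℂ] (Fin (n + m) → ℂ) × ℂ))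
    (fun k => fderiv ℂ (fun Z => fderiv ℂ f Z (E (j k))) 0 (E (i k))) (by
      rw [LinearMap.finrank_range_of_inj]
      · simp
        omega
      · intro a b hab
        refine hinj 0 (hMU hρ.zero_mem) (T.injective ?_)
        rw [← hdf, ← hdf]
        exact hab)
  obtain ⟨R, hR, hReval⟩ := CRHyp.exists_linear_eval_firstDerivs u
  refine ⟨c, R, hc, hR, ?_⟩
  have hpt : Tendsto (fun ζ : CRHyp.Space n => ((0 : CRHyp.Space n), star ζ)) (𝓝 0) (𝓝 0) :=
    tendsto_const_nhds.prodMk_nhds hstar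
  have hpt' : Tendsto (fun ζ : CRHyp.Space n => (ζ, (0 : CRHyp.Space n))) (𝓝 0) (𝓝 0) :=
    tendsto_id.prodMk_nhds tendsto_const_nhds
  filter_upwards [hstar.eventually key, hpt.eventually hρa.eventually_analyticAt,
    hpt'.eventually hsym] with ζ hkey han hs hζ
  obtain ⟨hζ0, hζV⟩ := hζ
  have hζ1 : ρ (ζ, 0) = 0 := by simpa [CRHyp.segre, CRHyp.slice] using hζ0
  -- Hermitian symmetry converts `ζ ∈ S_0` into `0 ∈ S_ζ`.
  have hζ2 : ρ (0, star ζ) = 0 := by simpa [hζ1] using hs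
  obtain ⟨a, b, ha, hb, h1, h2⟩ := hkey hζ2
  -- The normalization `ρ_z(0, 0) = 0` puts `E k` in the complex tangent space, hence in `V_I`.
  have htan : ∀ k ∈ I, fderiv ℂ ρ (0, star ζ) (E k, 0) = 0 := by
    intro k hk
    rw [← CRHyp.fderiv_slice han.differentiableAt]
    refine hζV ⟨⟨Submodule.subset_span ⟨k, hk, rfl⟩, trivial⟩, ?_⟩
    exact CRHyp.mem_complexTangent_of_eq_zero hρa.differentiableAt hsym
      (by rw [← hslice]; exact hρz k)
  rw [hReval, CRHyp.fderiv_slice han.differentiableAt]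
  refine mul_left_cancel₀ ha ?_
  rw [← h1 u, Finset.mul_sum]
  have hu' : fderiv ℂ f 0 u =
      ∑ k, c k • fderiv ℂ (fun Z => fderiv ℂ f Z (E (j k))) 0 (E (i k)) := hu
  rw [hu', map_sum, Finset.sum_mul]
  refine Finset.sum_congr rfl fun k _ => ?_
  have h3 : CRHyp.dzMulti (α k) (CRHyp.slice ρ ζ) 0 =
      fderiv ℂ (fun q => fderiv ℂ ρ q (E (j k), 0)) (0, star ζ) (E (i k), 0) := by
    rw [hdz, ← CRHyp.fderiv_fderiv_slice han]
    rfl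
  rw [h3, map_smul, smul_eq_mul, mul_assoc, h2 _ _ (htan _ (hsupp k (hj k)))
    (htan _ (hsupp k (hi k)))]
  ring
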